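/- Fix a recursive injective coding $\langle\cdot\rangle$ of the finite sequences of natural numbers by natural numbers, and let $\{e\}$ denote the $e$-th partial recursive function on $\omega$ in a standard (Gödel) numbering. For $y\in\omega$ and $R\subseteq\omega$ let $\psi(y,R)$ be the arithmetical condition, positive in $R$, $$(\exists a,x,e)\big\{\,y=\langle a,x\rangle \ \&\ \big(\,[a=\langle 0,e\rangle \ \&\ x=e]\ \vee\ [a=\langle 1,e\rangle \ \&\ (\exists t)(\forall s)\,(\{e\}(\langle t,s\rangle)\text{ is defined and } \langle \{e\}(\langle t,s\rangle),x\rangle\in R)]\,\big)\big\}.$$ For $\alpha,\beta\in{}^{\omega}2$ write $\alpha\subseteq\beta$ if $\beta(n)=1$ for every $n$ with $\alpha(n)=1$. Let $f:{}^{\omega}2\to{}^{\omega}2$ be the function determined by $$f(\alpha)(m)=1\iff \psi(m,\{n:\alpha(n)=1\})\qquad(\alpha\in{}^{\omega}2,\ m\in\omega).$$ Then: 1. $f$ is $\Sigma^0_4$-recursive, i.e. the set of all pairs $(\alpha,\sigma)$, where $\alpha\in{}^{\omega}2$ and $\sigma$ is a finite $0$-$1$ sequence which is an initial segment of $f(\alpha)$,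 is a (lightface) $\Sigma^0_4$ set; 2. $f$ is monotone, i.e. $\alpha\subseteq\beta$ implies $f(\alpha)\subseteq f(\beta)$; 3. $f$ has no hyperarithmetical fixed point, i.e. there is no $\alpha\in{}^{\omega}2$ with $f(\alpha)=\alpha$ for which the set $\{\langle\alpha(0),\dots,\alpha(n-1)\rangle : n\in\omega\}$ is a hyperarithmetical, equivalently (lightface) $\Delta^1_1$, subset of $\omega$. In particular there is a $\Sigma^0_4$-recursive function from the Cantor space to itself which is monotone for $\subseteq$ and has no hyperarithmetical fixed point. -/

import Mathlib

namespace EffDST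

/-- The Cantor space of all `0`-`1` sequences, `true` standing for `1`. Its pointwise order is
`α ≤ β ↔ ∀ n, α n = true → β n = true`, that is, inclusion of the sets coded by `α` and `β`. -/
abbrev Cantor : Type := ℕ → Bool

/-- The finite sequence `(α 0, …, α (n - 1))`. -/
def initSeg {T : Type} (α : ℕ → T) (n : ℕ) : List T :=
  (List.range n).map α

/-- The lightface pointclass of `Σ⁰ₙ` subsets of `(ℕ → T) × β`, for `n ≥ 1`, where `ℕ → T` has the
product topology and `T`, `β` are discrete. (For `T = ℕ` the first factor is the Baire space, for
`T = Bool` the Cantor space.)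
* A set is `Σ⁰₁` (semirecursive) if it is the union of a recursively enumerable family of basic open
  sets `{α | σ is an initial segment of α} × {b}`.
* A set is `Σ⁰ₙ₊₁` if it is the projection along `ℕ` of the complement of a `Σ⁰ₙ` set.
The level `0` is not used; no set belongs to it. -/
def IsSigma0 {T : Type} [Primcodable T] :
    ℕ → ∀ {β : Type} [Primcodable β], ((ℕ → T) → β → Prop) → Prop
  | 0, _, _, _ => False
  | 1, β, _, P =>
      ∃ W : List T × β → Prop, REPred W ∧ ∀ α b, P α b ↔ ∃ n, W (initSeg α n, b)
  | n + 2, β, _, P =>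
      ∃ Q : (ℕ → T) → β × ℕ → Prop, IsSigma0 (n + 1) Q ∧ ∀ α b, P α b ↔ ∃ k, ¬ Q α (b, k)

/-- A function `f` on the Cantor space is `Σ⁰ₙ`-recursive if the relation `f α ∈ N_σ` is `Σ⁰ₙ`, where
`N_σ` is the basic open set of all extensions of the finite sequence `σ`. -/
def IsSigma0Recursive (n : ℕ) (f : Cantor → Cantor) : Prop :=
  IsSigma0 n (fun (α : Cantor) (σ : List Bool) => initSeg (f α) σ.length = σ)

/-- The (lightface) `Σ¹₁` subsets of `ℕ`: the projections along the Baire space of `Π⁰₁` sets. -/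
def IsSigma11 (A : Set ℕ) : Prop :=
  ∃ U : (ℕ → ℕ) → ℕ → Prop, IsSigma0 1 U ∧ ∀ n, n ∈ A ↔ ∃ γ, ¬ U γ n

/-- The hyperarithmetical, i.e. `Δ¹₁`, subsets of `ℕ`. -/
def IsHYP (A : Set ℕ) : Prop :=
  IsSigma11 A ∧ IsSigma11 Aᶜ

/-- A recursive injective coding of the finite sequences of natural numbers. -/
def seqCode (l : List ℕ) : ℕ :=
  Encodable.encode l

/-- A sequence of natural numbers is hyperarithmetical if the set of the codes of its initial
segments is. -/
def IsHyperarithmetical (α : ℕ → ℕ) : Prop :=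
  IsHYP {c | ∃ n, c = seqCode (initSeg α n)}

/-- The `e`-th partial recursive function of one variable. -/
def phi (e : ℕ) : ℕ →. ℕ :=
  (Denumerable.ofNat Nat.Partrec.Code e).eval

/-- The arithmetical formula `ψ(y, R)`, positive in `R`, interpreted in the natural numbers. -/
def psi (y : ℕ) (R : Set ℕ) : Prop :=
  ∃ a x e, y = seqCode [a, x] ∧
    ((a = seqCode [0, e] ∧ x = e) ∨
     (a = seqCode [1, e] ∧ ∃ t, ∀ s, ∃ v ∈ phi e (seqCode [t, s]), seqCode [v, x] ∈ R))

end EffDST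

/-!
The function `f` sends `α` to the set of all `y` with `ψ(y, {n | α n = 1})`; it is monotone because
`ψ` is positive in `R`.

**Complexity.** For `R = {n | α n = 1}`, the condition `ψ(y, R)` has the form `∃ t, ∀ s, ∃ m, θ`, where
`θ` asks for a single value of `α` at a place computed primitive recursively (`psi_iff_answer`). So
`f α i = 1` is a `Σ⁰₃` and `f α i = 0` a `Π⁰₃` condition, and finitely many of them amount to a `Σ⁰₄`
condition, a code of a finite sequence serving as the outer witness (`initSeg_eq_iff`).

**Fixed points.** For a fixed point `R`, the sections `Rₐ = {x | ⟨a, x⟩ ∈ R}` include all singletons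
(`a = ⟨0, e⟩`) and the empty set, and are closed under recursive `⋃ₜ ⋂ₛ` (`a = ⟨1, e⟩`). Hence, as in
the effective form of Suslin's theorem, every `Δ¹₁` set is a section of `R`
(`HasTree.exists_section`). Indeed, let the membership of `x` in a set and in its complement be
expressed by the existence of infinite branches through `B x` and `C x`. The recursion theorem
gives indices `c(x, u, v)` whose sections are empty if `u` leaves `B x`, equal to `{x}` if only `v`
leaves `C x`, and equal to `⋃ₜ ⋂ₛ` of the sections at `c(x, u⌢t, v⌢s)` otherwise. As only one of
`B x` and `C x` has an infinite branch, `x` is in the section at `c(x, ∅, ∅)` exactly if `B x` has one: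
a branch of `B x` is a strategy for choosing `t`, a branch of `C x` is one for choosing `s`, and a
failure of either would produce a branch through the other tree. The union over all `x` of the
intersections of `{x}` with the section at `c(x, ∅, ∅)` is the given set.

If `R` were hyperarithmetical, then `{x | ⟨x, x⟩ ∉ R}` would be `Δ¹₁`, hence a section `Rₐ`, and `x = a`
gives a contradiction (`not_isHyperarithmetical_of_fixed`).
-/

namespace EffDST

open Nat.Partrec (Code)
open Encodable Denumerable

/-! ### Finite sequences and their codes -/

theorem initSeg_succ {T : Type} (α : ℕ → T) (n : ℕ) :
    initSeg α (n + 1) = initSeg α n ++ [α n] := by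
  simp [initSeg, List.range_succ]

theorem initSeg_succ' {T : Type} (α : ℕ → T) (n : ℕ) :
    initSeg α (n + 1) = α 0 :: initSeg (fun i => α (i + 1)) n := by
  simp [initSeg, List.range_succ_eq_map, Function.comp_def]

@[simp]
theorem length_initSeg {T : Type} (α : ℕ → T) (n : ℕ) : (initSeg α n).length = n := by
  simp [initSeg]

theorem getElem?_initSeg {T : Type} (α : ℕ → T) (n i : ℕ) :
    (initSeg α n)[i]? = if i < n then some (α i) else none := by
  by_cases h : i < n <;> simp [initSeg, h]

theorem take_initSeg {T : Type} (α : ℕ → T) {k n : ℕ} (h : k ≤ n) :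
    (initSeg α n).take k = initSeg α k := by
  simp [initSeg, ← List.map_take, List.take_range, h]

theorem initSeg_length_eq_iff {T : Type} (α : ℕ → T) (l : List T) :
    initSeg α l.length = l ↔ ∀ i b, l[i]? = some b → α i = b := by
  constructor
  · intro h i b hb
    rw [← h, getElem?_initSeg] at hb
    split_ifs at hb
    simpa using hb
  · intro h
    refine List.ext_getElem? fun i => ?_
    rw [getElem?_initSeg]
    split_ifs with hi
    · rw [List.getElem?_eq_getElem hi, h i _ (List.getElem?_eq_getElem hi)]
    · rw [List.getElem?_eq_none (by omega)]

/-- Dependent choice along finite sequences: a property of finite sequences that always passes to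
some one-step extension holds along a whole infinite branch. -/
theorem exists_branch {T : Type} (p : List T → Prop) (h0 : p [])
    (hs : ∀ v, p v → ∃ s, p (v ++ [s])) : ∃ γ : ℕ → T, ∀ n, p (initSeg γ n) := by
  choose g hg using hs
  let seq : ℕ → {v // p v} := fun n =>
    Nat.rec ⟨[], h0⟩ (fun _ v => ⟨v.1 ++ [g v.1 v.2], hg v.1 v.2⟩) n
  refine ⟨fun n => g (seq n).1 (seq n).2, fun n => ?_⟩
  have : initSeg (fun n => g (seq n).1 (seq n).2) n = (seq n).1 := by
    induction n with
    | zero => rfl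
    | succ n ih => rw [initSeg_succ, ih]
  rw [this]
  exact (seq n).2

/-- The `i`-th term of the finite sequence coded by `y`, or `0` if there is none. -/
def seqItem (i y : ℕ) : ℕ :=
  ((ofNat (List ℕ) y)[i]?).getD 0

@[simp]
theorem ofNat_seqCode (l : List ℕ) : ofNat (List ℕ) (seqCode l) = l :=
  ofNat_encode l

theorem seqCode_injective : Function.Injective seqCode :=
  encode_injective

theorem seqItem_seqCode (i : ℕ) (l : List ℕ) : seqItem i (seqCode l) = (l[i]?).getD 0 := by
  simp [seqItem]

theorem primrec_seqItem (i : ℕ) : Primrec (seqItem i) :=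
  Primrec.option_getD.comp
    (Primrec.list_getElem?.comp (Primrec.ofNat _) (Primrec.const i)) (Primrec.const 0)

theorem primrec_seqCode : Primrec seqCode :=
  Primrec.encode

theorem Primrec.seqCode_pair {α : Type*} [Primcodable α] {f g : α → ℕ} (hf : Primrec f)
    (hg : Primrec g) : Primrec fun a => seqCode [f a, g a] :=
  primrec_seqCode.comp
    (Primrec.list_cons.comp hf (Primrec.list_cons.comp hg (Primrec.const [])))

theorem phi_encode (c : Code) : phi (encode c) = c.eval := by
  simp [phi]

/-! ### The operator given by `ψ` -/

theorem psi_seqCode_pair (a x : ℕ) (R : Set ℕ) :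
    psi (seqCode [a, x]) R ↔ a = seqCode [0, x] ∨
      ∃ e, a = seqCode [1, e] ∧
        ∃ t, ∀ s, ∃ v ∈ phi e (seqCode [t, s]), seqCode [v, x] ∈ R := by
  constructor
  · rintro ⟨a', x', e, h, h'⟩
    obtain ⟨rfl, rfl⟩ : a = a' ∧ x = x' := by simpa using seqCode_injective h
    rcases h' with ⟨rfl, rfl⟩ | h'
    exacts [Or.inl rfl, Or.inr ⟨e, h'⟩]
  · rintro (h | ⟨e, h⟩)
    exacts [⟨a, x, x, rfl, Or.inl ⟨h, rfl⟩⟩, ⟨a, x, e, rfl, Or.inr h⟩]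

theorem psi_mono (y : ℕ) {R S : Set ℕ} (h : R ⊆ S) : psi y R → psi y S := by
  rintro ⟨a, x, e, hy, h' | ⟨ha, t, ht⟩⟩
  · exact ⟨a, x, e, hy, Or.inl h'⟩
  · refine ⟨a, x, e, hy, Or.inr ⟨ha, t, fun s => ?_⟩⟩
    obtain ⟨v, hv, hR⟩ := ht s
    exact ⟨v, hv, h hR⟩

/-! ### The complexity of the operator -/

/-- The answer of `α` to a query: the queries `0` and `1` have the fixed answers `false` and `true`,
and `j + 2` asks for the value `α j`. -/
def answer (α : Cantor) : ℕ → Bool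
  | 0 => false
  | 1 => true
  | j + 2 => α j

/-- The answer can be read off from a finite initial segment of `α`. -/
theorem getElem?_cons_initSeg (α : Cantor) (n q : ℕ) :
    (false :: true :: initSeg α n)[q]? = if q < n + 2 then some (answer α q) else none := by
  match q with
  | 0 => simp [answer]
  | 1 => simp [answer]
  | j + 2 => simp [answer, getElem?_initSeg]

/-- The query whose answer tells if the matrix of `ψ(y, ·)` holds for the witnesses `t`, `s`, with
the computation of `{e}(⟨t, s⟩)` restricted to `m` steps. -/
def query (p : ℕ × ℕ × ℕ × ℕ) : ℕ :=
  let a := seqItem 0 p.1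
  let x := seqItem 1 p.1
  let e := seqItem 1 a
  if p.1 = seqCode [a, x] then
    if a = seqCode [0, x] then 1
    else if a = seqCode [1, e] then
      ((Code.evaln p.2.2.2 (ofNat Code e) (seqCode [p.2.1, p.2.2.1])).map
        fun v => seqCode [v, x] + 2).getD 0
    else 0
  else 0

theorem primrec_query : Primrec query := by
  have hy : Primrec fun p : ℕ × ℕ × ℕ × ℕ => p.1 := Primrec.fst
  have ha := (primrec_seqItem 0).comp hy
  have hx := (primrec_seqItem 1).comp hy
  have he := (primrec_seqItem 1).comp ha
  have ht : Primrec fun p : ℕ × ℕ × ℕ × ℕ => p.2.1 := Primrec.fst.comp Primrec.snd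
  have hs : Primrec fun p : ℕ × ℕ × ℕ × ℕ => p.2.2.1 :=
    Primrec.fst.comp (Primrec.snd.comp Primrec.snd)
  have hm : Primrec fun p : ℕ × ℕ × ℕ × ℕ => p.2.2.2 :=
    Primrec.snd.comp (Primrec.snd.comp Primrec.snd)
  refine Primrec.ite (Primrec.eq.comp hy (Primrec.seqCode_pair ha hx))
    (Primrec.ite (Primrec.eq.comp ha (Primrec.seqCode_pair (Primrec.const 0) hx))
      (Primrec.const 1)
      (Primrec.ite (Primrec.eq.comp ha (Primrec.seqCode_pair (Primrec.const 1) he))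
        (Primrec.option_getD.comp (Primrec.option_map (Code.primrec_evaln.comp
          (Primrec.pair (Primrec.pair hm ((Primrec.ofNat Code).comp he))
            (Primrec.seqCode_pair ht hs))) ?_) (Primrec.const 0)) (Primrec.const 0)))
    (Primrec.const 0)
  exact Primrec.nat_add.comp (Primrec.seqCode_pair Primrec.snd (hx.comp Primrec.fst))
    (Primrec.const 2)

theorem psi_iff_answer (y : ℕ) (α : Cantor) :
    psi y {n | α n = true} ↔ ∃ t, ∀ s, ∃ m, answer α (query (y, t, s, m)) = true := by
  by_cases hy : y = seqCode [seqItem 0 y, seqItem 1 y]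
  swap
  · refine iff_of_false ?_ ?_
    · rintro ⟨a, x, e, rfl, -⟩
      simp [seqItem_seqCode] at hy
    · simp [query, hy, answer]
  generalize seqItem 0 y = a, seqItem 1 y = x at hy
  subst hy
  rw [psi_seqCode_pair]
  by_cases ha : a = seqCode [0, x]
  · simp [query, seqItem_seqCode, ha, answer]
  by_cases he : a = seqCode [1, seqItem 1 a]
  swap
  · refine iff_of_false ?_ ?_
    · rintro (h | ⟨e, rfl, -⟩)
      · exact ha h
      · simp [seqItem_seqCode] at he
    · simp [query, seqItem_seqCode, ha, he, answer]
  generalize seqItem 1 a = e at he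
  subst he
  have hne : ∀ x e, seqCode [1, e] ≠ seqCode [0, x] := fun x e h => by
    simpa using seqCode_injective h
  have key : (∃ e', seqCode [1, e] = seqCode [1, e'] ∧ ∃ t, ∀ s,
      ∃ v ∈ phi e' (seqCode [t, s]), seqCode [v, x] ∈ {n | α n = true}) ↔
      ∃ t, ∀ s, ∃ v ∈ phi e (seqCode [t, s]), α (seqCode [v, x]) = true := by
    constructor
    · rintro ⟨e', h, h'⟩
      obtain rfl : e = e' := by simpa using seqCode_injective h
      exact h'
    · exact fun h => ⟨e, rfl, h⟩
  rw [key, or_iff_right (hne _ _)]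
  refine exists_congr fun t => forall_congr' fun s => ?_
  simp only [query, seqItem_seqCode, List.getElem?_cons_zero, List.getElem?_cons_succ,
    Option.getD_some, if_true, if_neg (hne _ _), phi, Code.evaln_complete]
  constructor
  · rintro ⟨v, ⟨m, hm⟩, hv⟩
    refine ⟨m, ?_⟩
    rw [Option.mem_def] at hm
    simpa [hm, answer] using hv
  · rintro ⟨m, hm⟩
    cases hv : Code.evaln m (ofNat Code e) (seqCode [t, s]) with
    | none => simp [hv, answer] at hm
    | some v => exact ⟨v, ⟨m, hv⟩, by simpa [hv, answer] using hm⟩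

/-- The query needed to confirm that the `i`-th value of `f α` is `b`. If `b = true`, then the
witness `t` is the `i`-th term of the sequence coded by `k`, the universal variable is `w`, and `s`
is the number of steps. If `b = false`, then `w` is a possible witness `t` to be refuted, by the
counterexample `s`, for every number `m` of steps. -/
def valueQuery (i k w s m : ℕ) (b : Bool) : ℕ :=
  query (bif b then (i, seqItem i k, w, s) else (i, w, s, m))

theorem primrec_valueQuery :
    Primrec fun p : (ℕ × ℕ × ℕ × ℕ × ℕ) × Bool =>
      valueQuery p.1.1 p.1.2.1 p.1.2.2.1 p.1.2.2.2.1 p.1.2.2.2.2 p.2 := by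
  have hi : Primrec fun p : (ℕ × ℕ × ℕ × ℕ × ℕ) × Bool => p.1.1 := Primrec.fst.comp Primrec.fst
  have h1 : Primrec fun p : (ℕ × ℕ × ℕ × ℕ × ℕ) × Bool => p.1.2 := Primrec.snd.comp Primrec.fst
  have hw := Primrec.fst.comp (Primrec.snd.comp h1)
  have hs := Primrec.fst.comp (Primrec.snd.comp (Primrec.snd.comp h1))
  have hm := Primrec.snd.comp (Primrec.snd.comp (Primrec.snd.comp h1))
  have hitem : Primrec₂ seqItem := Primrec.option_getD.comp₂
    (Primrec.list_getElem?.comp₂ ((Primrec.ofNat _).comp₂ Primrec₂.right) Primrec₂.left)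
    (Primrec₂.const 0)
  exact primrec_query.comp (Primrec.cond Primrec.snd
    (hi.pair ((hitem.comp hi (Primrec.fst.comp h1)).pair (hw.pair hs)))
    (hi.pair (hw.pair (hs.pair hm))))

/-- The relation `f α ∈ N_σ` in `Σ⁰₄` form. The outer witness `k` codes the witnesses `t` of
`ψ(i, ·)` for all `i` with `σ i = 1` at once; the universal variable `r` codes a position `i` of `σ`
and an instance `w` of the universal quantifier of `ψ(i, ·)` or of its negation. -/
theorem initSeg_eq_iff (f : Cantor → Cantor)
    (hf : ∀ α m, f α m = true ↔ psi m {n | α n = true}) (α : Cantor) (σ : List Bool) :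
    initSeg (f α) σ.length = σ ↔ ∃ k, ∀ r : ℕ, ∃ s, ∀ m, ∀ b, σ[r.unpair.1]? = some b →
      answer α (valueQuery r.unpair.1 k r.unpair.2 s m b) = b := by
  rw [initSeg_length_eq_iff]
  have hf' : ∀ i, f α i = true ↔ ∃ t, ∀ s, ∃ m, answer α (query (i, t, s, m)) = true :=
    fun i => (hf α i).trans (psi_iff_answer i α)
  constructor
  · intro h
    have hk : ∀ i, ∃ t, f α i = true → ∀ s, ∃ m, answer α (query (i, t, s, m)) = true := by
      intro i
      by_cases hi : f α i = true
      · obtain ⟨t, ht⟩ := (hf' i).1 hi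
        exact ⟨t, fun _ => ht⟩
      · exact ⟨0, fun h => absurd h hi⟩
    choose t ht using hk
    refine ⟨seqCode (initSeg t σ.length), fun r => ?_⟩
    generalize r.unpair.1 = i, r.unpair.2 = w
    rcases hσ : σ[i]? with _ | _ | _
    · simp
    · have hi : ¬ f α i = true := by simp [h i _ hσ]
      rw [hf'] at hi
      push Not at hi
      obtain ⟨s, hs⟩ := hi w
      refine ⟨s, fun m b hb => ?_⟩
      obtain rfl : false = b := by simpa using hb
      simpa [valueQuery] using hs m
    · obtain ⟨m, hm⟩ := ht i (h i _ hσ) w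
      refine ⟨m, fun m' b hb => ?_⟩
      obtain rfl : true = b := by simpa using hb
      have hi : i < σ.length := (List.getElem?_eq_some_iff.1 hσ).1
      have hitem : seqItem i (seqCode (initSeg t σ.length)) = t i := by
        rw [seqItem_seqCode, getElem?_initSeg, if_pos hi, Option.getD_some]
      simpa [valueQuery, hitem] using hm
  · rintro ⟨k, hk⟩ i b hb
    have hk' : ∀ w, ∃ s, ∀ m, answer α (valueQuery i k w s m b) = b := fun w => by
      obtain ⟨s, hs⟩ := hk (Nat.pair i w)
      simp only [Nat.unpair_pair] at hs
      exact ⟨s, fun m => hs m b hb⟩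
    cases b with
    | true =>
      refine (hf' i).2 ⟨seqItem i k, fun w => ?_⟩
      obtain ⟨s, hs⟩ := hk' w
      exact ⟨s, by simpa [valueQuery] using hs 0⟩
    | false =>
      rw [← Bool.not_eq_true, hf']
      push Not
      intro w
      obtain ⟨s, hs⟩ := hk' w
      exact ⟨s, fun m => by simpa [valueQuery] using hs m⟩

theorem isSigma0Recursive_four (f : Cantor → Cantor)
    (hf : ∀ α m, f α m = true ↔ psi m {n | α n = true}) : IsSigma0Recursive 4 f := by
  let V : List Bool × (((List Bool × ℕ) × ℕ) × ℕ) → Bool → ℕ := fun p b =>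
    valueQuery p.2.1.2.unpair.1 p.2.1.1.2 p.2.1.2.unpair.2 p.2.2 p.1.length.unpair.1 b
  let W : List Bool × (((List Bool × ℕ) × ℕ) × ℕ) → Prop := fun p =>
    (p.2.1.1.1[p.2.1.2.unpair.1]?.map fun b =>
      decide ((false :: true :: p.1)[V p b]? = some (!b))) = some true
  have hW : PrimrecPred W := by
    have h1 : Primrec fun p : List Bool × (((List Bool × ℕ) × ℕ) × ℕ) => p.2.1 :=
      Primrec.fst.comp Primrec.snd
    have hr : Primrec fun p : List Bool × (((List Bool × ℕ) × ℕ) × ℕ) => p.2.1.2.unpair :=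
      Primrec.unpair.comp (Primrec.snd.comp h1)
    have hV : Primrec₂ V := by
      have h := (Primrec.fst.comp hr).pair ((Primrec.snd.comp (Primrec.fst.comp h1)).pair
        ((Primrec.snd.comp hr).pair ((Primrec.snd.comp Primrec.snd).pair
          (Primrec.fst.comp (Primrec.unpair.comp (Primrec.list_length.comp Primrec.fst))))))
      exact primrec_valueQuery.comp ((h.comp Primrec.fst).pair Primrec.snd)
    refine Primrec.eq.comp (Primrec.option_map (Primrec.list_getElem?.comp
      (Primrec.fst.comp (Primrec.fst.comp h1)) (Primrec.fst.comp hr)) ?_) (Primrec.const _)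
    exact PrimrecPred.decide (Primrec.eq.comp (Primrec.list_getElem?.comp
      (Primrec.list_cons.comp (Primrec.const false) (Primrec.list_cons.comp (Primrec.const true)
        (Primrec.fst.comp Primrec.fst))) (hV.comp Primrec.fst Primrec.snd))
      (Primrec.option_some.comp (Primrec.not.comp Primrec.snd)))
  have hRE : REPred W := by
    obtain ⟨_, h⟩ := hW
    exact ComputablePred.to_re ⟨_, h.to_comp⟩
  refine ⟨fun α b => ∃ r, ¬ ∃ s, ¬ ∃ n, W (initSeg α n, ((b, r), s)),
    ⟨fun α b => ∃ s, ¬ ∃ n, W (initSeg α n, (b, s)),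
      ⟨fun α b => ∃ n, W (initSeg α n, b), ⟨W, hRE, fun _ _ => Iff.rfl⟩, fun _ _ => Iff.rfl⟩,
      fun _ _ => Iff.rfl⟩, fun α σ => ?_⟩
  refine (initSeg_eq_iff f hf α σ).trans ?_
  push Not
  refine exists_congr fun k => forall_congr' fun r => exists_congr fun s => ?_
  constructor
  · intro h n hn
    obtain ⟨b, hb, hb'⟩ := Option.map_eq_some_iff.1 hn
    rw [decide_eq_true_iff, getElem?_cons_initSeg] at hb'
    split_ifs at hb'
    have := h (initSeg α n).length.unpair.1 b hb
    simp only [V, Option.some.injEq] at hb'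
    rw [this] at hb'
    simp at hb'
  · intro h m b hb
    by_contra hne
    -- An initial segment whose length codes `m` and exceeds the query.
    refine h (Nat.pair m (valueQuery r.unpair.1 k r.unpair.2 s m b)) ?_
    refine Option.map_eq_some_iff.2 ⟨b, hb, ?_⟩
    rw [decide_eq_true_iff, getElem?_cons_initSeg]
    simp only [V, length_initSeg, Nat.unpair_pair]
    rw [if_pos (by have := Nat.right_le_pair m (valueQuery r.unpair.1 k r.unpair.2 s m b); omega)]
    simpa [Bool.eq_not] using hne

/-! ### `Σ¹₁` sets and trees -/

/-- A set of natural numbers has a tree representation if, primitive recursively in `x`, there is a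
set of finite sequences that contains all initial segments of some `γ` if and only if `x` is in `A`.
This set need not be closed under initial segments, since only its infinite branches matter. -/
def HasTree (A : Set ℕ) : Prop :=
  ∃ B : ℕ → List ℕ → Bool, Primrec₂ B ∧ ∀ x, x ∈ A ↔ ∃ γ : ℕ → ℕ, ∀ n, B x (initSeg γ n) = true

theorem REPred.exists_stage {α : Type} [Primcodable α] {W : α → Prop} (hW : REPred W) :
    ∃ c : Code, ∀ a, W a ↔ ∃ m, (Code.evaln m c (encode a)).isSome = true := by
  obtain ⟨c, hc⟩ := Code.exists_code.1 hW
  refine ⟨c, fun a => ?_⟩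
  have h : (c.eval (encode a)).Dom ↔ W a := by
    simp [hc, Part.assert]
  rw [← h, Part.dom_iff_mem]
  simp only [Code.evaln_complete, Option.isSome_iff_exists, Option.mem_def]
  exact exists_comm

theorem IsSigma11.hasTree {A : Set ℕ} (hA : IsSigma11 A) : HasTree A := by
  obtain ⟨U, ⟨W, hW, hU⟩, hA⟩ := hA
  obtain ⟨c, hc⟩ := REPred.exists_stage hW
  -- A sequence whose length codes `(k, m)` is tested on its first `k` terms, for `m` steps.
  refine ⟨fun x u => !(Code.evaln u.length.unpair.2 c
    (encode (u.take u.length.unpair.1, x))).isSome, ?_, fun x => ?_⟩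
  · have hl : Primrec fun p : ℕ × List ℕ => p.2.length.unpair :=
      Primrec.unpair.comp (Primrec.list_length.comp Primrec.snd)
    exact Primrec.not.comp (Primrec.option_isSome.comp (Code.primrec_evaln.comp
      (((Primrec.snd.comp hl).pair (Primrec.const c)).pair (Primrec.encode.comp
        ((Primrec.list_take.comp (Primrec.fst.comp hl) Primrec.snd).pair Primrec.fst)))))
  · rw [hA]
    refine exists_congr fun γ => ?_
    simp only [hU, hc, not_exists, length_initSeg, Bool.not_eq_true', Bool.not_eq_true,
      take_initSeg γ (Nat.unpair_left_le _)]
    constructor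
    · exact fun h n => h _ _
    · intro h k m
      have := h (Nat.pair k m)
      rwa [Nat.unpair_pair] at this

/-- Projection of a set with a tree representation along a primitive recursive relation: the witness is
prefixed to the branch. -/
theorem HasTree.exists {A : Set ℕ} (hA : HasTree A) {r : ℕ → ℕ → Prop} [DecidableRel r]
    (hr : PrimrecRel r) :
    HasTree {x | ∃ z ∈ A, r x z} := by
  obtain ⟨B, hB, hA⟩ := hA
  refine ⟨fun x u => List.casesOn u true fun z u' => decide (r x z) && B z u', ?_, fun x => ?_⟩
  · refine Primrec.list_casesOn (f := fun p : ℕ × List ℕ => p.2) Primrec.snd (Primrec.const true)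
      (h := fun p q => decide (r p.1 q.1) && B q.1 q.2) ?_
    exact Primrec.and.comp
      (hr.decide.comp (Primrec.fst.comp Primrec.fst) (Primrec.fst.comp Primrec.snd))
      (hB.comp (Primrec.fst.comp Primrec.snd) (Primrec.snd.comp Primrec.snd))
  · constructor
    · rintro ⟨z, hz, hxz⟩
      obtain ⟨γ, hγ⟩ := (hA z).1 hz
      refine ⟨fun n => Nat.casesOn n z γ, fun n => ?_⟩
      cases n with
      | zero => rfl
      | succ n => rw [initSeg_succ']; simp [hxz, hγ]
    · rintro ⟨γ, hγ⟩
      have h : ∀ n, r x (γ 0) ∧ B (γ 0) (initSeg (fun i => γ (i + 1)) n) = true := fun n => by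
        simpa [initSeg_succ'] using hγ (n + 1)
      exact ⟨γ 0, (hA _).2 ⟨_, fun n => (h n).2⟩, (h 0).1⟩

/-! ### Sections of fixed points -/

section Separation

variable {B C : ℕ → List ℕ → Bool}

/-- The index of the section attached to `x` and the finite sequences `u`, `v`: the section is empty
if `u` leaves `B x`, and otherwise `{x}` if `v` leaves `C x`. If neither happens, then it is
`⋃ₜ ⋂ₛ` of the sections attached to `x`, `u ++ [t]`, `v ++ [s]`, provided that the program `c`
computes their indices from `⟨x, u, v⟩` and `⟨t, s⟩`. -/
def sectionIndex (B C : ℕ → List ℕ → Bool) (c : Code) (p : ℕ × List ℕ × List ℕ) : ℕ :=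
  bif !B p.1 p.2.1 then seqCode []
  else bif !C p.1 p.2.2 then seqCode [0, p.1]
  else seqCode [1, encode (c.curry (encode p))]

theorem primrec_sectionIndex (hB : Primrec₂ B) (hC : Primrec₂ C) :
    Primrec₂ (sectionIndex B C) := by
  have h2 : Primrec fun q : Code × ℕ × List ℕ × List ℕ => q.2.2 := Primrec.snd.comp Primrec.snd
  have h1 : Primrec fun q : Code × ℕ × List ℕ × List ℕ => q.2.1 := Primrec.fst.comp Primrec.snd
  exact Primrec.cond (Primrec.not.comp (hB.comp h1 (Primrec.fst.comp h2))) (Primrec.const _)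
    (Primrec.cond (Primrec.not.comp (hC.comp h1 (Primrec.snd.comp h2)))
      (Primrec.seqCode_pair (Primrec.const 0) h1)
      (Primrec.seqCode_pair (Primrec.const 1) (Primrec.encode.comp
        (Code.primrec₂_curry.comp Primrec.fst (Primrec.encode.comp Primrec.snd)))))

/-- By the recursion theorem, some program computes the indices that it is supposed to compute. -/
theorem exists_code_sectionIndex (hB : Primrec₂ B) (hC : Primrec₂ C) :
    ∃ c : Code, ∀ x u v t s, phi (encode (c.curry (encode (x, u, v)))) (seqCode [t, s]) =
      Part.some (sectionIndex B C c (x, u ++ [t], v ++ [s])) := by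
  let g : Code → ℕ → ℕ := fun c n =>
    let p := (decode (α := ℕ × List ℕ × List ℕ) n.unpair.1).getD (0, [], [])
    sectionIndex B C c (p.1, p.2.1 ++ [seqItem 0 n.unpair.2], p.2.2 ++ [seqItem 1 n.unpair.2])
  have hg : Primrec₂ g := by
    have hn : Primrec fun q : Code × ℕ => q.2.unpair := Primrec.unpair.comp Primrec.snd
    have hp : Primrec fun q : Code × ℕ =>
        (decode (α := ℕ × List ℕ × List ℕ) q.2.unpair.1).getD (0, [], []) :=
      Primrec.option_getD.comp (Primrec.decode.comp (Primrec.fst.comp hn)) (Primrec.const _)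
    have hi := fun i => (primrec_seqItem i).comp (Primrec.snd.comp hn)
    exact (primrec_sectionIndex hB hC).comp Primrec.fst ((Primrec.fst.comp hp).pair
      ((Primrec.list_concat.comp (Primrec.fst.comp (Primrec.snd.comp hp)) (hi 0)).pair
        (Primrec.list_concat.comp (Primrec.snd.comp (Primrec.snd.comp hp)) (hi 1))))
  obtain ⟨c, hc⟩ := Code.fixed_point₂ (f := fun c n => Part.some (g c n)) hg.to_comp.partrec₂
  refine ⟨c, fun x u v t s => ?_⟩
  rw [phi_encode, Code.eval_curry, hc]
  simp [g, seqItem_seqCode]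

/-- If exactly one of `B x` and `C x` has an infinite branch, for every `x`, then the set of all `x`
for which `B x` has one is a section of every fixed point of `ψ`, with an index that does not depend
on the fixed point. -/
theorem exists_section (hB : Primrec₂ B) (hC : Primrec₂ C)
    (h : ∀ x, (∃ γ : ℕ → ℕ, ∀ n, C x (initSeg γ n) = true) ↔
      ¬ ∃ γ : ℕ → ℕ, ∀ n, B x (initSeg γ n) = true) :
    ∃ a, ∀ R : Set ℕ, (∀ y, y ∈ R ↔ psi y R) → ∀ x,
      seqCode [a, x] ∈ R ↔ ∃ γ : ℕ → ℕ, ∀ n, B x (initSeg γ n) = true := by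
  obtain ⟨c, hc⟩ := exists_code_sectionIndex hB hC
  let g : ℕ → ℕ := fun n => if seqItem 1 n = 0 then seqCode [0, seqItem 0 n] else
    sectionIndex B C c (seqItem 0 n, [], [])
  have hg : Primrec g := by
    refine Primrec.ite (Primrec.eq.comp (primrec_seqItem 1) (Primrec.const 0))
      (Primrec.seqCode_pair (Primrec.const 0) (primrec_seqItem 0)) ?_
    exact (primrec_sectionIndex hB hC).comp (Primrec.const c)
      ((primrec_seqItem 0).pair (Primrec.const ([], [])))
  obtain ⟨d, hd⟩ := Code.exists_code.1 (Nat.Partrec.of_primrec (Primrec.nat_iff.1 hg))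
  refine ⟨seqCode [1, encode d], fun R hR x => ?_⟩
  have hzero : ∀ z, seqCode [seqCode [0, z], x] ∈ R ↔ x = z := by
    intro z
    rw [hR, psi_seqCode_pair]
    constructor
    · rintro (h | ⟨e, h, -⟩)
      · simpa using (seqCode_injective h).symm
      · simpa using seqCode_injective h
    · rintro rfl
      exact Or.inl rfl
  have hnil : seqCode [seqCode [], x] ∉ R := by
    rw [hR, psi_seqCode_pair]
    rintro (h | ⟨e, h, -⟩) <;> simpa using seqCode_injective h
  have hone : ∀ (e : Code) (k : ℕ → ℕ → ℕ),
      (∀ t s, phi (encode e) (seqCode [t, s]) = Part.some (k t s)) →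
      (seqCode [seqCode [1, encode e], x] ∈ R ↔ ∃ t, ∀ s, seqCode [k t s, x] ∈ R) := by
    intro e k hk
    rw [hR, psi_seqCode_pair]
    constructor
    · rintro (h | ⟨e', h, t, ht⟩)
      · simpa using seqCode_injective h
      · obtain rfl : encode e = e' := by simpa using seqCode_injective h
        exact ⟨t, fun s => by simpa [hk] using ht s⟩
    · rintro ⟨t, ht⟩
      exact Or.inr ⟨_, rfl, t, fun s => by simpa [hk] using ht s⟩
  have hstep : ∀ u v, seqCode [sectionIndex B C c (x, u, v), x] ∈ R ↔ B x u = true ∧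
      (C x v = true → ∃ t, ∀ s,
        seqCode [sectionIndex B C c (x, u ++ [t], v ++ [s]), x] ∈ R) := by
    intro u v
    rcases hu : B x u with _ | _
    · simp [sectionIndex, hu, hnil]
    rcases hv : C x v with _ | _
    · simp [sectionIndex, hu, hv, hzero]
    rw [← hone _ _ fun t s => hc x u v t s]
    simp [sectionIndex, hu, hv]
  have hmain : seqCode [sectionIndex B C c (x, [], []), x] ∈ R ↔
      ∃ γ : ℕ → ℕ, ∀ n, B x (initSeg γ n) = true := by
    constructor
    · -- Otherwise `C x` has an infinite branch, and the witnesses `t` along it form one of `B x`.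
      intro hmem
      by_contra hB'
      obtain ⟨δ, hδ⟩ := (h x).2 hB'
      obtain ⟨γ, hγ⟩ := exists_branch
        (fun u => seqCode [sectionIndex B C c (x, u, initSeg δ u.length), x] ∈ R) hmem
        (fun u hu => by
          obtain ⟨t, ht⟩ := ((hstep _ _).1 hu).2 (hδ _)
          exact ⟨t, by simpa [initSeg_succ] using ht (δ u.length)⟩)
      exact hB' ⟨γ, fun n => ((hstep _ _).1 (hγ n)).1⟩
    · -- Otherwise the counterexamples `s` along the branch of `B x` form an infinite branch of `C x`.
      rintro ⟨γ, hγ⟩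
      by_contra hmem
      obtain ⟨δ, hδ⟩ := exists_branch
        (fun v => seqCode [sectionIndex B C c (x, initSeg γ v.length, v), x] ∉ R) hmem
        (fun v hv => by
          rw [hstep] at hv
          push Not at hv
          obtain ⟨s, hs⟩ := (hv (hγ _)).2 (γ v.length)
          exact ⟨s, by simpa [initSeg_succ] using hs⟩)
      refine (h x).1 ⟨δ, fun n => ?_⟩ ⟨γ, hγ⟩
      have := hδ n
      rw [hstep] at this
      push Not at this
      exact (this (hγ _)).1
  rw [← hmain, hone d (fun t s => g (seqCode [t, s])) (fun t s => by rw [phi_encode, hd]; rfl)]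
  simp only [g, seqItem_seqCode, List.getElem?_cons_zero, List.getElem?_cons_succ, Option.getD_some]
  constructor
  · rintro ⟨t, ht⟩
    obtain rfl : x = t := (hzero t).1 (by simpa using ht 0)
    simpa using ht 1
  · intro hx
    refine ⟨x, fun s => ?_⟩
    split_ifs
    exacts [(hzero x).2 rfl, hx]

end Separation

/-- The separation argument for trees shows that every set with a tree representation whose
complement has one is a section of every fixed point of `ψ`. -/
theorem HasTree.exists_section {A : Set ℕ} (hA : HasTree A) (hA' : HasTree Aᶜ) :
    ∃ a, ∀ R : Set ℕ, (∀ y, y ∈ R ↔ psi y R) → ∀ x, seqCode [a, x] ∈ R ↔ x ∈ A := by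
  obtain ⟨B, hB, hAB⟩ := hA
  obtain ⟨C, hC, hAC⟩ := hA'
  obtain ⟨a, ha⟩ := EffDST.exists_section hB hC fun x => by rw [← hAC, ← hAB]; rfl
  exact ⟨a, fun R hR x => by rw [ha R hR, hAB]⟩

/-! ### The diagonal argument -/

/-- The diagonal is obtained by guessing an initial segment of `α` that reaches `⟨x, x⟩`. The same
form works for both values of `α`, so the diagonal and its complement are covered. -/
theorem IsHyperarithmetical.hasTree_diagonal {α : ℕ → ℕ} (hα : IsHyperarithmetical α) (b : ℕ) :
    HasTree {x | α (seqCode [x, x]) = b} := by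
  have h := hα.1.hasTree.exists (r := fun x z => (ofNat (List ℕ) z)[seqCode [x, x]]? = some b)
    (Primrec.eq.comp (Primrec.list_getElem?.comp ((Primrec.ofNat _).comp Primrec.snd)
      (Primrec.seqCode_pair Primrec.fst Primrec.fst)) (Primrec.const _))
  convert h using 1
  ext x
  constructor
  · intro hx
    refine ⟨_, ⟨seqCode [x, x] + 1, rfl⟩, ?_⟩
    rw [ofNat_seqCode, getElem?_initSeg, if_pos (Nat.lt_succ_self _)]
    exact congrArg some hx
  · rintro ⟨_, ⟨n, rfl⟩, hx⟩
    rw [ofNat_seqCode, getElem?_initSeg] at hx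
    split_ifs at hx
    simpa using hx

/-- The set of all `x` with `⟨x, x⟩` outside a hyperarithmetical fixed point would be a section of
it, and the index of that section is contradictory. -/
theorem not_isHyperarithmetical_of_fixed {α : Cantor}
    (hα : ∀ y, α y = true ↔ psi y {n | α n = true}) :
    ¬ IsHyperarithmetical fun n => (α n).toNat := by
  intro h
  have h0 : HasTree {x | α (seqCode [x, x]) = false} := by
    simpa using h.hasTree_diagonal 0
  have h1 : HasTree {x | α (seqCode [x, x]) = false}ᶜ := by
    simpa [Set.compl_ofPred] using h.hasTree_diagonal 1
  obtain ⟨a, ha⟩ := h0.exists_section h1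
  have := ha {n | α n = true} hα a
  simp at this

end EffDST

theorem corollary2 :
    ∃ f : EffDST.Cantor → EffDST.Cantor,
      (∀ α m, f α m = true ↔ EffDST.psi m {n | α n = true}) ∧
      EffDST.IsSigma0Recursive 4 f ∧
      Monotone f ∧
      ∀ α, f α = α → ¬ EffDST.IsHyperarithmetical (fun n => (α n).toNat) := by
  classical
  have hf : ∀ (α : EffDST.Cantor) m,
      decide (EffDST.psi m {n | α n = true}) = true ↔ EffDST.psi m {n | α n = true} :=
    fun α m => decide_eq_true_iff
  refine ⟨fun α m => decide (EffDST.psi m {n | α n = true}), hf,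
    EffDST.isSigma0Recursive_four _ hf, fun α β h m hm => ?_, fun α hα => ?_⟩
  · rw [hf] at hm ⊢
    exact EffDST.psi_mono m (fun n hn => h n hn) hm
  · refine EffDST.not_isHyperarithmetical_of_fixed fun y => ?_
    exact (congrArg (· = true) (congrFun hα y)).symm.to_iff.trans (hf α y)
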